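/- Let $(\Omega,\mathcal F,P)$ be a probability space and let $\mathcal A\subseteq\mathcal B\subseteq\mathcal F$ be $\sigma$-algebras. For $\mathcal G\in\{\mathcal A,\mathcal B\}$ let $L_\infty(\mathcal G)=L_\infty(\Omega,\mathcal G,P)$ with the $P$-a.s. order, let $L_\infty^+(\mathcal G)$ be its cone of non-negative elements, and let the weak* topology be $\sigma(L_\infty(\mathcal G),L_1(\mathcal G))$, the coarsest topology on $L_\infty(\mathcal G)$ for which $X\mapsto E[fX]$ is continuous for every $f\in L_1(\mathcal G)$; $L_\infty^+(\mathcal G)$ carries the induced topology. Write $X_n\downarrow X$ (resp. $X_n\uparrow X$) if $(X_n)_{n\in\mathbb N}$ is non-increasing (resp. non-decreasing) and converges to $X$ $P$-a.s. A map $x:L_\infty(\mathcal B)\to L_\infty(\mathcal A)$ is *continuous from above* (resp. *from below*) if $X_n\downarrow X$ implies $x(X_n)\downarrow x(X)$ (resp. $X_n\uparrow X$ implies $x(X_n)\uparrow x(X)$), for all $X_n,X\in L_\infty(\mathcal B)$; it is *weak\* continuous* if it is continuous for the weak* topologies on both spaces; it is *$\mathcal A$-homogeneous* if $x(cX)=c\,x(X)$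 for all $X\in L_\infty(\mathcal B)$ and $c\in L_\infty^+(\mathcal A)$. A map $M:L_\infty^+(\mathcal B)\to L_\infty^+(\mathcal A)$ is *sublinear* if $M(X+Y)\le M(X)+M(Y)$ and $M(\lambda X)=\lambda M(X)$ for all $X,Y\in L_\infty^+(\mathcal B)$ and real $\lambda\ge0$; a map $m:L_\infty^+(\mathcal B)\to L_\infty^+(\mathcal A)$ is *superlinear* if $m(X+Y)\ge m(X)+m(Y)$ and $m(\lambda X)=\lambda m(X)$ for the same $X,Y,\lambda$; $M$ is *weak $\mathcal A$-homogeneous* if $M(1_SX)=1_SM(X)$ for all $S\in\mathcal A$ and $X\in L_\infty^+(\mathcal B)$. 1. Let $x:L_\infty(\mathcal B)\to L_\infty(\mathcal A)$ be an $\mathcal A$-homogeneous monotone linear operator with $x(1)=1$. Then the following are equivalent: (i) $x$ is continuous from below; (ii) $x$ is continuous from above; (iii) $x$ is weak* continuous. 2. Let $x:L\to L_\infty(\mathcal A)$ be a monotone linear operator on a linear subspace $L\subseteq L_\infty(\mathcal B)$, and let $M:L_\infty^+(\mathcal B)\to L_\infty^+(\mathcal A)$ be weak* continuous, weak $\mathcal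 A$-homogeneous and sublinear, with $x(X)\le M(Y)$ for all $X\in L$, $Y\in L_\infty^+(\mathcal B)$ with $X\le Y$. Then $x$ extends to a monotone linear operator $x:L_\infty(\mathcal B)\to L_\infty(\mathcal A)$ which is weak* continuous and $\mathcal A$-homogeneous and satisfies $x(X)\le M(Y)$ for all $X\in L_\infty(\mathcal B)$, $Y\in L_\infty^+(\mathcal B)$ with $X\le Y$. 3. Let $x:L\to L_\infty(\mathcal A)$ be a linear operator on a linear subspace $L\subseteq L_\infty(\mathcal B)$, let $M:L_\infty^+(\mathcal B)\to L_\infty^+(\mathcal A)$ be weak* continuous and sublinear and $m:L_\infty^+(\mathcal B)\to L_\infty^+(\mathcal A)$ superlinear, with $m(Z)+x(X)\le M(Y)$ for all $X\in L$, $Y,Z\in L_\infty^+(\mathcal B)$ with $Z+X\le Y$. Then $x$ extends to a monotone linear operator $x:L_\infty(\mathcal B)\to L_\infty(\mathcal A)$ which is weak* continuous and satisfies $m(Z)+x(X)\le M(Y)$ for all $X\in L_\infty(\mathcal B)$, $Y,Z\in L_\infty^+(\mathcal B)$ with $Z+X\le Y$, and, equivalently, $m(X)\le x(X)\le M(X)$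 for all $X\in L_\infty^+(\mathcal B)$. -/

import Mathlib

open MeasureTheory Filter Topology
open scoped ENNReal

noncomputable section

namespace LInfOp

variable {Ω : Type*}

/-- `L_∞(Ω, m, P)` for a sub-σ-algebra `m`: the classes in `L_∞(Ω, F, P)` which have an
`m`-measurable representative. It carries the `P`-a.s. order of `L_∞(Ω, F, P)`. -/
abbrev LInf (m : MeasurableSpace Ω) {F : MeasurableSpace Ω} (P : Measure Ω) : Type _ :=
  lpMeas ℝ ℝ m ∞ P

/-- `L_1(Ω, m, P)`. -/
abbrev LOne (m : MeasurableSpace Ω) {F : MeasurableSpace Ω} (P : Measure Ω) : Type _ :=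
  lpMeas ℝ ℝ m 1 P

/-- The cone `L_∞^+(Ω, m, P)` of non-negative elements. -/
abbrev LInfPos (m : MeasurableSpace Ω) {F : MeasurableSpace Ω} (P : Measure Ω) : Type _ :=
  {X : LInf m P // 0 ≤ X}

/-- The constant `1` as an element of `L_∞(Ω, m, P)`. -/
def LInf.one (m : MeasurableSpace Ω) {F : MeasurableSpace Ω} (P : Measure Ω)
    [IsFiniteMeasure P] : LInf m P :=
  ⟨Lp.const ∞ P (1 : ℝ), mem_lpMeas_iff_aestronglyMeasurable.2
    ((stronglyMeasurable_const (b := (1 : ℝ))).aestronglyMeasurable.congr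
      (Lp.coeFn_const (p := ∞) (μ := P) (1 : ℝ)).symm)⟩

/-- The weak* topology `σ(L_∞(m), L_1(m))`: the coarsest topology such that for every
`f ∈ L_1(m)` the map `X ↦ E[f X]` is continuous. -/
@[reducible] def weakStar (m : MeasurableSpace Ω) {F : MeasurableSpace Ω} (P : Measure Ω) : TopologicalSpace (LInf m P) :=
  ⨅ f : LOne m P, TopologicalSpace.induced
    (fun X : LInf m P => ∫ ω, (f : Lp ℝ 1 P) ω * (X : Lp ℝ ∞ P) ω ∂P) inferInstance

/-- The topology induced by the weak* topology on the cone `L_∞^+(m)`. -/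
@[reducible] def weakStarPos (m : MeasurableSpace Ω) {F : MeasurableSpace Ω} (P : Measure Ω) : TopologicalSpace (LInfPos m P) :=
  TopologicalSpace.induced Subtype.val (weakStar m P)

/-- `X_n ↓ X`: the sequence is non-increasing and converges to `X` `P`-a.s. -/
def DecreasesTo {m F : MeasurableSpace Ω} {P : Measure Ω}
    (X : ℕ → LInf m P) (Y : LInf m P) :
    Prop :=
  Antitone X ∧
    ∀ᵐ ω ∂P, Tendsto (fun n => (X n : Lp ℝ ∞ P) ω) atTop (𝓝 ((Y : Lp ℝ ∞ P) ω))

/-- `X_n ↑ X`: the sequence is non-decreasing and converges to `X` `P`-a.s. -/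
def IncreasesTo {m F : MeasurableSpace Ω} {P : Measure Ω}
    (X : ℕ → LInf m P) (Y : LInf m P) :
    Prop :=
  Monotone X ∧
    ∀ᵐ ω ∂P, Tendsto (fun n => (X n : Lp ℝ ∞ P) ω) atTop (𝓝 ((Y : Lp ℝ ∞ P) ω))

section Operators

variable {A B F : MeasurableSpace Ω} {P : Measure Ω}

def ContinuousFromAbove (x : LInf B P → LInf A P) : Prop :=
  ∀ (X : ℕ → LInf B P) (Y : LInf B P), DecreasesTo X Y → DecreasesTo (fun n => x (X n)) (x Y)

def ContinuousFromBelow (x : LInf B P → LInf A P) : Prop :=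
  ∀ (X : ℕ → LInf B P) (Y : LInf B P), IncreasesTo X Y → IncreasesTo (fun n => x (X n)) (x Y)

/-- Continuity for the weak* topologies on both sides. -/
def WeakStarContinuous (x : LInf B P → LInf A P) : Prop :=
  Continuous[weakStar B P, weakStar A P] x

/-- Weak* continuity of an operator between the positive cones. -/
def WeakStarContinuousPos (M : LInfPos B P → LInfPos A P) : Prop :=
  Continuous[weakStarPos B P, weakStarPos A P] M

/-- `A`-homogeneity: `x (c X) = c x(X)` for all `X ∈ L_∞(B)` and all `c ∈ L_∞^+(A)`.
Here `Y` is the class of the product `c X`. -/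
def Homogeneous (x : LInf B P → LInf A P) : Prop :=
  ∀ (c : LInfPos A P) (X Y : LInf B P),
    (∀ᵐ ω ∂P, (Y : Lp ℝ ∞ P) ω = (c.1 : Lp ℝ ∞ P) ω * (X : Lp ℝ ∞ P) ω) →
    ∀ᵐ ω ∂P, (x Y : Lp ℝ ∞ P) ω = (c.1 : Lp ℝ ∞ P) ω * (x X : Lp ℝ ∞ P) ω

/-- Weak `A`-homogeneity on the positive cone: `M (1_S X) = 1_S M(X)` for all
`X ∈ L_∞^+(B)` and all `S ∈ A`. Here `Y` is the class of `1_S X`. -/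
def WeakHomogeneousPos (M : LInfPos B P → LInfPos A P) : Prop :=
  ∀ (S : Set Ω), MeasurableSet[A] S → ∀ X Y : LInfPos B P,
    (∀ᵐ ω ∂P, (Y.1 : Lp ℝ ∞ P) ω = S.indicator (X.1 : Lp ℝ ∞ P) ω) →
    ∀ᵐ ω ∂P, ((M Y).1 : Lp ℝ ∞ P) ω = S.indicator ((M X).1 : Lp ℝ ∞ P) ω

/-- Sublinearity (with homogeneity for non-negative real scalars). -/
def Sublinear (M : LInfPos B P → LInfPos A P) : Prop :=
  (∀ X Y Z : LInfPos B P, Z.1 = X.1 + Y.1 → (M Z).1 ≤ (M X).1 + (M Y).1) ∧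
  ∀ (c : ℝ), 0 ≤ c → ∀ X Z : LInfPos B P, Z.1 = c • X.1 → (M Z).1 = c • (M X).1

/-- Superlinearity (with homogeneity for non-negative real scalars). -/
def Superlinear (m : LInfPos B P → LInfPos A P) : Prop :=
  (∀ X Y Z : LInfPos B P, Z.1 = X.1 + Y.1 → (m X).1 + (m Y).1 ≤ (m Z).1) ∧
  ∀ (c : ℝ), 0 ≤ c → ∀ X Z : LInfPos B P, Z.1 = c • X.1 → (m Z).1 = c • (m X).1

/-- The majorant condition for `x` on a linear subspace `L`. -/
def MajorantCondition {L : Submodule ℝ (LInf B P)} (x : L → LInf A P)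
    (M : LInfPos B P → LInfPos A P) : Prop :=
  ∀ (X : L) (Y : LInfPos B P), (X : LInf B P) ≤ Y.1 → x X ≤ (M Y).1

/-- The sandwich condition for `x` on a linear subspace `L`. -/
def SandwichCondition {L : Submodule ℝ (LInf B P)} (x : L → LInf A P)
    (m M : LInfPos B P → LInfPos A P) : Prop :=
  ∀ (X : L) (Y Z : LInfPos B P), Z.1 + (X : LInf B P) ≤ Y.1 → (m Z).1 + x X ≤ (M Y).1

end Operators

end LInfOp

end

open LInfOp

/-! Two mechanisms carry all three parts: a Hahn-Banach extension with values in `L_∞(A)`, and the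
correspondence between weak* continuity and an adjoint `L_1(A) → L_1(B)`.

Extension. `L_∞(A)` is Dedekind complete (`LInf.exists_isLUB`), so the classical one-dimensional
step and Zorn's lemma apply. Domination is encoded by a convex cone in `L_∞(B) × L_∞(A)` rather than
by a sublinear map. For the sandwich theorem it consists of the pairs `(X, V)` with `M(Y) - m(Z) ≤
V` for some `Y, Z ≥ 0`, `Z + X ≤ Y` (`sandwichCone`). The majorant theorem is the case `m = 0`.
Domination along this cone gives `m ≤ x ≤ M` on the positive cone, hence monotonicity, since `m ≥
0`.

Continuity. Let `f ≥ 0` be in `L_1(A)`. If `E[f x(X_n)] → 0` whenever `X_n ↓ 0`, then `S ↦ E[f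
x(1_S)]` is a countably additive measure on `B` that vanishes on null sets, and Radon-Nikodym gives
`g` in `L_1(B)` with `E[f x(X)] = E[g X]` (`exists_density`). Splitting a general `f` into positive
and negative parts yields the adjoint (`exists_adjoint`), and an operator with an adjoint is weak*
continuous. The sequential hypothesis comes from continuity from above in the first part, and from
`0 ≤ x(X_n) ≤ M(X_n)` and weak* continuity of `M` in the other two.

Homogeneity. Since `0 ≤ x(1_S X) ≤ 1_S M(X)` for `X ≥ 0`, the operator commutes with indicators of
sets in `A`. With `g` the density of `E[x(·)]` this forces `x(X) = E[g X | A]`, and factors from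
`L_∞(A)` pull out of the conditional expectation. -/

namespace LInfOp

/-! ### Hahn-Banach extension dominated along a cone -/

section Extension

open Submodule

variable {E G : Type*} [AddCommGroup E] [Module ℝ E] [AddCommGroup G] [Module ℝ G]
  [PartialOrder G] [IsOrderedAddMonoid G] [PosSMulMono ℝ G]

/-- One-dimensional extension step of the vector-valued Hahn-Banach theorem. -/
theorem exists_lt_extension_of_cone
    (hG : ∀ S : Set G, S.Nonempty → BddAbove S → ∃ a, IsLUB S a)
    (s : PointedCone ℝ (E × G)) (hs : ∀ x, ∃ v, (x, v) ∈ s) (f : E →ₗ.[ℝ] G)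
    (hf : ∀ (x : f.domain) (v : G), ((x : E), v) ∈ s → f x ≤ v) (hdom : f.domain ≠ ⊤) :
    ∃ g, f < g ∧ ∀ (x : g.domain) (v : G), ((x : E), v) ∈ s → g x ≤ v := by
  obtain ⟨y, -, hy⟩ : ∃ y ∈ ⊤, y ∉ f.domain := SetLike.exists_of_lt (lt_top_iff_ne_top.2 hdom)
  -- `c` is the value to be given to the extension at `y`; the two conditions are domination at `x -
  -- y` and at `x + y`.
  obtain ⟨c, le_c, c_le⟩ :
      ∃ c, (∀ (x : f.domain) (v : G), ((x : E) - y, v) ∈ s → f x - v ≤ c) ∧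
        ∀ (x : f.domain) (v : G), ((x : E) + y, v) ∈ s → c ≤ v - f x := by
    have key : ∀ (x x' : f.domain) (v v' : G), ((x : E) - y, v) ∈ s → ((x' : E) + y, v') ∈ s →
        f x - v ≤ v' - f x' := by
      intro x x' v v' h h'
      have h1 := s.add_mem h h'
      rw [Prod.mk_add_mk, sub_add_add_cancel, ← Submodule.coe_add] at h1
      have h2 := hf _ _ h1
      rw [f.map_add] at h2
      rw [sub_le_sub_iff, add_comm v' v]
      exact h2
    -- Full projection of `s` makes the set of lower constraints nonempty (via `u`) and bounded
    -- above (via `w`), so its supremum exists.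
    obtain ⟨w, hw⟩ := hs (0 + y)
    obtain ⟨u, hu⟩ := hs (0 - y)
    obtain ⟨c, hc⟩ := hG {a | ∃ (x : f.domain) (v : G), ((x : E) - y, v) ∈ s ∧ a = f x - v}
      ⟨_, 0, u, hu, rfl⟩ ⟨w - f 0, by rintro a ⟨x, v, h, rfl⟩; exact key x 0 v w h hw⟩
    exact ⟨c, fun x v h => hc.1 ⟨x, v, h, rfl⟩, fun x' v' h' => hc.2
      (by rintro a ⟨x, v, h, rfl⟩; exact key x x' v v' h h')⟩
  refine ⟨f.supSpanSingleton y c hy, ?_, ?_⟩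
  · refine lt_iff_le_not_ge.2 ⟨f.left_le_sup _ _, fun H => ?_⟩
    replace H := LinearPMap.domain_mono.monotone H
    rw [LinearPMap.domain_supSpanSingleton, sup_le_iff, span_le, Set.singleton_subset_iff] at H
    exact hy H.2
  · rintro ⟨z, hz⟩ v hzs
    rcases mem_sup.1 hz with ⟨x, hx, y', hy', rfl⟩
    rcases mem_span_singleton.1 hy' with ⟨r, rfl⟩
    simp only at hzs
    rw [LinearPMap.supSpanSingleton_apply_mk _ _ _ _ _ hx]
    -- Dividing by `|r|` reduces a general vector to the form `x ± y`, where the choice of `c`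
    -- applies.
    have scale : ∀ t : ℝ, 0 < t → (t⁻¹ • (x + r • y), t⁻¹ • v) ∈ s := fun t ht =>
      s.smul_mem (inv_pos.2 ht).le hzs
    rcases lt_trichotomy r 0 with (hr | hr | hr)
    · have h1 := scale (-r) (neg_pos.2 hr)
      have e : (-r)⁻¹ • (x + r • y) = (((-r)⁻¹ • (⟨x, hx⟩ : f.domain) : f.domain) : E) - y := by
        rw [smul_add, smul_smul, inv_neg, neg_mul, inv_mul_cancel₀ hr.ne, neg_one_smul,
          ← sub_eq_add_neg]
        rfl
      rw [e] at h1
      have h2 := smul_le_smul_of_nonneg_left (le_c _ _ h1) (neg_pos.2 hr).le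
      rw [f.map_smul, smul_sub, smul_smul, smul_smul, mul_inv_cancel₀ (neg_pos.2 hr).ne',
        one_smul, one_smul, neg_smul] at h2
      have h3 : f ⟨x, hx⟩ ≤ -(r • c) + v := sub_le_iff_le_add.1 h2
      rwa [← sub_eq_neg_add, le_sub_iff_add_le] at h3
    · subst r
      simp only [zero_smul, add_zero] at hzs ⊢
      simpa using hf ⟨x, hx⟩ v hzs
    · have h1 := scale r hr
      have e : r⁻¹ • (x + r • y) = ((r⁻¹ • (⟨x, hx⟩ : f.domain) : f.domain) : E) + y := by
        rw [smul_add, smul_smul, inv_mul_cancel₀ hr.ne', one_smul]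
        rfl
      rw [e] at h1
      have h2 := smul_le_smul_of_nonneg_left (c_le _ _ h1) hr.le
      rw [f.map_smul, smul_sub, smul_smul, smul_smul, mul_inv_cancel₀ hr.ne',
        one_smul, one_smul, le_sub_iff_add_le'] at h2
      exact h2

/-- Vector-valued Hahn-Banach theorem: a linear map into a Dedekind complete ordered vector space
which is dominated along a cone `s` with full projection extends to a linear map dominated
along `s`. -/
theorem exists_extension_of_cone
    (hG : ∀ S : Set G, S.Nonempty → BddAbove S → ∃ a, IsLUB S a)
    (s : PointedCone ℝ (E × G)) (hs : ∀ x, ∃ v, (x, v) ∈ s) (f : E →ₗ.[ℝ] G)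
    (hf : ∀ (x : f.domain) (v : G), ((x : E), v) ∈ s → f x ≤ v) :
    ∃ g : E →ₗ[ℝ] G, (∀ x : f.domain, g x = f x) ∧ ∀ x v, (x, v) ∈ s → g x ≤ v := by
  set S := {p : E →ₗ.[ℝ] G | ∀ (x : p.domain) (v : G), ((x : E), v) ∈ s → p x ≤ v}
  have hSc : ∀ c, c ⊆ S → IsChain (· ≤ ·) c → ∀ y ∈ c, ∃ ub ∈ S, ∀ z ∈ c, z ≤ ub := by
    intro c hcs c_chain y hy
    have cne : c.Nonempty := ⟨y, hy⟩
    have hcd : DirectedOn (· ≤ ·) c := c_chain.directedOn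
    refine ⟨LinearPMap.sSup c hcd, ?_, fun _ ↦ LinearPMap.le_sSup hcd⟩
    rintro ⟨x, hx⟩ v hxs
    have hdir : DirectedOn (· ≤ ·) (LinearPMap.domain '' c) :=
      directedOn_image.2 (hcd.mono LinearPMap.domain_mono.monotone)
    rcases (mem_sSup_of_directed (cne.image _) hdir).1 hx with ⟨_, ⟨f, hfc, rfl⟩, hfx⟩
    have h : f ≤ LinearPMap.sSup c hcd := LinearPMap.le_sSup _ hfc
    have e : f ⟨x, hfx⟩ = LinearPMap.sSup c hcd ⟨x, hx⟩ := h.2 rfl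
    rw [← e]
    exact hcs hfc ⟨x, hfx⟩ v hxs
  obtain ⟨q, hpq, hqs, hq⟩ := zorn_le_nonempty₀ S hSc f hf
  have htop : q.domain = ⊤ := by
    by_contra hne
    rcases exists_lt_extension_of_cone hG s hs q hqs hne with ⟨r, hqr, hr⟩
    exact hqr.ne' ((hq hr hqr.le).antisymm hqr.le)
  obtain ⟨q_dom, q⟩ := q
  obtain rfl : q_dom = ⊤ := htop
  refine ⟨q.comp (LinearMap.id.codRestrict ⊤ fun _ ↦ trivial), ?_, ?_⟩
  · exact fun x => (hpq.2 rfl).symm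
  · exact fun x v hx => hqs ⟨x, _⟩ v hx

end Extension

end LInfOp

namespace LInfOp

/-! ### Almost-sure calculus and Dedekind completeness of `L_∞` -/

section Basic

variable {Ω : Type*} {m F : MeasurableSpace Ω} {P : Measure Ω}

theorem LInf.le_iff {X Y : LInf m P} :
    X ≤ Y ↔ ∀ᵐ ω ∂P, (X : Lp ℝ ∞ P) ω ≤ (Y : Lp ℝ ∞ P) ω :=
  (Lp.coeFn_le X.1 Y.1).symm

theorem LInf.ext_ae {X Y : LInf m P}
    (h : ∀ᵐ ω ∂P, (X : Lp ℝ ∞ P) ω = (Y : Lp ℝ ∞ P) ω) : X = Y :=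
  Subtype.ext (Lp.ext h)

theorem LInf.nonneg_iff {X : LInf m P} : 0 ≤ X ↔ ∀ᵐ ω ∂P, 0 ≤ (X : Lp ℝ ∞ P) ω :=
  (Lp.coeFn_nonneg X.1).symm

theorem LInf.coeFn_add (X Y : LInf m P) :
    ∀ᵐ ω ∂P, ((X + Y : LInf m P) : Lp ℝ ∞ P) ω = (X : Lp ℝ ∞ P) ω + (Y : Lp ℝ ∞ P) ω :=
  Lp.coeFn_add X.1 Y.1

theorem LInf.coeFn_sub (X Y : LInf m P) :
    ∀ᵐ ω ∂P, ((X - Y : LInf m P) : Lp ℝ ∞ P) ω = (X : Lp ℝ ∞ P) ω - (Y : Lp ℝ ∞ P) ω :=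
  Lp.coeFn_sub X.1 Y.1

theorem LInf.coeFn_neg (X : LInf m P) :
    ∀ᵐ ω ∂P, ((-X : LInf m P) : Lp ℝ ∞ P) ω = -(X : Lp ℝ ∞ P) ω :=
  Lp.coeFn_neg X.1

theorem LInf.coeFn_smul (c : ℝ) (X : LInf m P) :
    ∀ᵐ ω ∂P, ((c • X : LInf m P) : Lp ℝ ∞ P) ω = c * (X : Lp ℝ ∞ P) ω :=
  Lp.coeFn_smul c X.1

theorem LInf.coeFn_zero : ∀ᵐ ω ∂P, ((0 : LInf m P) : Lp ℝ ∞ P) ω = 0 :=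
  Lp.coeFn_zero ℝ ∞ P

instance : PosSMulMono ℝ (LInf m P) where
  smul_le_smul_of_nonneg_left c hc X Y h := by
    rw [LInf.le_iff] at h ⊢
    filter_upwards [h, LInf.coeFn_smul c X, LInf.coeFn_smul c Y] with ω h1 h2 h3
    rw [h2, h3]
    exact mul_le_mul_of_nonneg_left h1 hc

theorem LInf.exists_bound (X : LInf m P) : ∃ C, ∀ᵐ ω ∂P, |(X : Lp ℝ ∞ P) ω| ≤ C :=
  ⟨_, ae_le_lpNorm_exponent_top (Lp.memLp X.1)⟩

theorem LInf.aestronglyMeasurable (X : LInf m P) : AEStronglyMeasurable[m] (X : Lp ℝ ∞ P) P :=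
  lpMeas.aestronglyMeasurable X

theorem LInf.integrable_mul {f : Ω → ℝ} (hf : Integrable f P) (X : LInf m P) :
    Integrable (fun ω => f ω * (X : Lp ℝ ∞ P) ω) P :=
  let ⟨_, hC⟩ := X.exists_bound
  hf.mul_bdd (Lp.aestronglyMeasurable X.1) hC

theorem LInf.integrable [IsFiniteMeasure P] (X : LInf m P) : Integrable (X : Lp ℝ ∞ P) P := by
  simpa using X.integrable_mul (integrable_const (1 : ℝ))

/-- The class in `L_∞(m)` of an essentially bounded `m`-measurable function. -/
noncomputable def LInf.ofBound (hm : m ≤ F) (h : Ω → ℝ) (hh : AEStronglyMeasurable[m] h P) {C : ℝ}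
    (hC : ∀ᵐ ω ∂P, |h ω| ≤ C) : LInf m P :=
  ⟨(memLp_top_of_bound (hh.mono hm) C hC).toLp h, mem_lpMeas_iff_aestronglyMeasurable.2
    (hh.congr (MemLp.coeFn_toLp _).symm)⟩

theorem LInf.coeFn_ofBound (hm : m ≤ F) (h : Ω → ℝ) (hh : AEStronglyMeasurable[m] h P) {C : ℝ}
    (hC : ∀ᵐ ω ∂P, |h ω| ≤ C) :
    ∀ᵐ ω ∂P, (LInf.ofBound hm h hh hC : Lp ℝ ∞ P) ω = h ω :=
  MemLp.coeFn_toLp (memLp_top_of_bound (hh.mono hm) C hC)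

theorem LInf.coeFn_one [IsFiniteMeasure P] :
    ∀ᵐ ω ∂P, (LInf.one m P : Lp ℝ ∞ P) ω = 1 :=
  Lp.coeFn_const (p := ∞) (μ := P) (1 : ℝ)

/-- The class of an integrable `m`-measurable function in `L_1(m)`. -/
noncomputable def LOne.ofIntegrable (f : Ω → ℝ) (hf : Integrable f P)
    (hm : AEStronglyMeasurable[m] f P) : LOne m P :=
  ⟨hf.toL1 f, mem_lpMeas_iff_aestronglyMeasurable.2 (hm.congr hf.coeFn_toL1.symm)⟩

theorem LOne.coeFn_ofIntegrable (f : Ω → ℝ) (hf : Integrable f P)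
    (hm : AEStronglyMeasurable[m] f P) :
    ∀ᵐ ω ∂P, (LOne.ofIntegrable f hf hm : Lp ℝ 1 P) ω = f ω :=
  hf.coeFn_toL1

theorem LOne.integrable (f : LOne m P) : Integrable (f : Lp ℝ 1 P) P :=
  L1.integrable_coeFn f.1

theorem LOne.aestronglyMeasurable (f : LOne m P) : AEStronglyMeasurable[m] (f : Lp ℝ 1 P) P :=
  lpMeas.aestronglyMeasurable f

theorem aestronglyMeasurable_indicator {f : Ω → ℝ} (hf : AEStronglyMeasurable[m] f P) {S : Set Ω}
    (hS : MeasurableSet[m] S) : AEStronglyMeasurable[m] (S.indicator f) P := by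
  obtain ⟨g, hg, hfg⟩ := hf
  refine ⟨S.indicator g, hg.indicator hS, ?_⟩
  filter_upwards [hfg] with ω h
  by_cases hω : ω ∈ S <;> simp [hω, h]

theorem aestronglyMeasurable_sup {f g : Ω → ℝ} (hf : AEStronglyMeasurable[m] f P)
    (hg : AEStronglyMeasurable[m] g P) : AEStronglyMeasurable[m] (fun ω => f ω ⊔ g ω) P := by
  obtain ⟨f', hf', hff'⟩ := hf
  obtain ⟨g', hg', hgg'⟩ := hg
  refine ⟨fun ω => f' ω ⊔ g' ω, continuous_sup.comp_stronglyMeasurable (hf'.prodMk hg'), ?_⟩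
  filter_upwards [hff', hgg'] with ω h1 h2
  rw [h1, h2]

/-- The class of `1_S X`. -/
noncomputable def LInf.indicator (hm : m ≤ F) (S : Set Ω) (hS : MeasurableSet[m] S)
    (X : LInf m P) : LInf m P :=
  LInf.ofBound hm (S.indicator (X : Lp ℝ ∞ P))
    (aestronglyMeasurable_indicator X.aestronglyMeasurable hS) (C := X.exists_bound.choose) <| by
      filter_upwards [X.exists_bound.choose_spec] with ω hω
      refine le_trans ?_ hω
      by_cases h : ω ∈ S <;> simp [h]

theorem LInf.coeFn_indicator (hm : m ≤ F) (S : Set Ω) (hS : MeasurableSet[m] S)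
    (X : LInf m P) :
    ∀ᵐ ω ∂P, (LInf.indicator hm S hS X : Lp ℝ ∞ P) ω = S.indicator (X : Lp ℝ ∞ P) ω :=
  LInf.coeFn_ofBound hm _ _ _

/-- The space `L_∞(m)` is Dedekind complete. -/
theorem LInf.exists_isLUB [IsFiniteMeasure P] (hm : m ≤ F) (S : Set (LInf m P))
    (hS : S.Nonempty) (hb : BddAbove S) : ∃ Z, IsLUB S Z := by
  obtain ⟨x₀, hx₀⟩ := hS
  obtain ⟨u, hu⟩ := hb
  -- `T` contains `S` and is closed under finite suprema. An element of `T` of maximal integral is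
  -- therefore the least upper bound; it arises as a countable supremum of a maximizing sequence.
  set T : Set (LInf m P) := {a | ∀ b ∈ upperBounds S, a ≤ b}
  have hST : S ⊆ T := fun a ha b hb => hb ha
  set I : LInf m P → ℝ := fun a => ∫ ω, (a : Lp ℝ ∞ P) ω ∂P
  have hI : Monotone I := fun a b h => integral_mono_ae a.integrable b.integrable (LInf.le_iff.1 h)
  have hbdd : BddAbove (I '' T) := ⟨I u, by rintro _ ⟨a, ha, rfl⟩; exact hI (ha u hu)⟩
  obtain ⟨r, -, hr, hrT⟩ := exists_seq_tendsto_sSup (S := I '' T) ⟨_, x₀, hST hx₀, rfl⟩ hbdd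
  choose a haT har using hrT
  choose g hg hag using fun n => (a n).aestronglyMeasurable
  have hgle : ∀ b ∈ upperBounds S, ∀ᵐ ω ∂P, ∀ n, g n ω ≤ (b : Lp ℝ ∞ P) ω := by
    intro b hb
    rw [ae_all_iff]
    intro n
    filter_upwards [LInf.le_iff.1 (haT n b hb), hag n] with ω h1 h2
    rwa [← h2]
  obtain ⟨C, hC⟩ := u.exists_bound
  obtain ⟨D, hD⟩ := (a 0).exists_bound
  -- Almost everywhere the representatives are bounded above by `u`, so the real supremum is genuine
  -- there; default values can occur only on a null set.
  have hh : StronglyMeasurable[m] (fun ω => ⨆ n, g n ω) :=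
    (Measurable.iSup fun n => (hg n).measurable).stronglyMeasurable
  have hbd : ∀ᵐ ω ∂P, |⨆ n, g n ω| ≤ C + D := by
    filter_upwards [hgle u hu, hC, hD, hag 0] with ω h1 h2 h3 h4
    have h5 : ⨆ n, g n ω ≤ (u : Lp ℝ ∞ P) ω := ciSup_le h1
    have h6 : g 0 ω ≤ ⨆ n, g n ω := le_ciSup ⟨_, Set.forall_mem_range.2 h1⟩ 0
    rw [h4] at h3
    rw [abs_le] at *
    constructor <;> linarith
  set Z := LInf.ofBound hm _ hh.aestronglyMeasurable hbd with hZ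
  have hZc := LInf.coeFn_ofBound hm _ hh.aestronglyMeasurable hbd
  have hZT : ∀ b ∈ upperBounds S, Z ≤ b := by
    intro b hb
    rw [LInf.le_iff]
    filter_upwards [hgle b hb, hZc] with ω h1 h2
    rw [h2]
    exact ciSup_le h1
  have haZ : ∀ n, a n ≤ Z := by
    intro n
    rw [LInf.le_iff]
    filter_upwards [hgle u hu, hZc, hag n] with ω h1 h2 h3
    rw [h2, h3]
    exact le_ciSup (f := fun n => g n ω) ⟨_, Set.forall_mem_range.2 h1⟩ n
  have hmax : ∀ b ∈ T, I b ≤ I Z := fun b hb => (le_csSup hbdd ⟨b, hb, rfl⟩).trans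
    (le_of_tendsto' hr fun n => (har n) ▸ hI (haZ n))
  refine ⟨Z, fun b hbS => ?_, hZT⟩
  obtain ⟨E, hE⟩ := b.exists_bound
  have hsup : ∀ᵐ ω ∂P, |(b : Lp ℝ ∞ P) ω ⊔ (Z : Lp ℝ ∞ P) ω| ≤ E ⊔ (C + D) := by
    filter_upwards [hE, hbd, hZc] with ω h1 h2 h3
    rw [← h3] at h2
    exact abs_max_le_max_abs_abs.trans (max_le_max h1 h2)
  set W := LInf.ofBound hm _
    (aestronglyMeasurable_sup b.aestronglyMeasurable Z.aestronglyMeasurable) hsup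
  have hWc := LInf.coeFn_ofBound hm _
    (aestronglyMeasurable_sup b.aestronglyMeasurable Z.aestronglyMeasurable) hsup
  -- `W = b ⊔ Z` is again in `T`, so by maximality its integral does not exceed that of `Z`. With `Z
  -- ≤ W` this forces `W = Z`, that is `b ≤ Z`.
  have hWT : W ∈ T := by
    intro d hd
    rw [LInf.le_iff]
    filter_upwards [hWc, LInf.le_iff.1 (hd hbS), LInf.le_iff.1 (hZT d hd)] with ω h1 h2 h3
    rw [h1]
    exact max_le h2 h3
  have hZW : ∀ᵐ ω ∂P, (Z : Lp ℝ ∞ P) ω ≤ (W : Lp ℝ ∞ P) ω := by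
    filter_upwards [hWc] with ω h1
    rw [h1]
    exact le_max_right _ _
  have hE : ∀ᵐ ω ∂P, (Z : Lp ℝ ∞ P) ω = (W : Lp ℝ ∞ P) ω :=
    (integral_eq_iff_of_ae_le Z.integrable W.integrable hZW).1
      ((integral_mono_ae Z.integrable W.integrable hZW).antisymm (hmax W hWT))
  rw [LInf.le_iff]
  filter_upwards [hE, hWc] with ω h1 h2
  rw [h1, h2]
  exact le_max_left _ _

end Basic

end LInfOp

namespace LInfOp

/-! ### Densities of positive functionals on `L_∞` -/

section Density

theorem exists_bound_simpleFunc {Ω : Type*} {m : MeasurableSpace Ω} (s : SimpleFunc Ω ℝ) :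
    ∃ C, ∀ ω, |s ω| ≤ C :=
  s.exists_forall_norm_le

variable {Ω : Type*} {m F : MeasurableSpace Ω} {P : Measure Ω}

/-- The class of the indicator function of `S`. -/
noncomputable def LInf.ind (hm : m ≤ F) (P : Measure Ω) (S : Set Ω) (hS : MeasurableSet[m] S) :
    LInf m P :=
  LInf.ofBound hm (S.indicator fun _ => (1 : ℝ))
    (stronglyMeasurable_const.indicator hS).aestronglyMeasurable (C := 1) <| by
      filter_upwards with ω
      by_cases h : ω ∈ S <;> simp [h]

theorem LInf.coeFn_ind (hm : m ≤ F) (S : Set Ω) (hS : MeasurableSet[m] S) :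
    ∀ᵐ ω ∂P, (LInf.ind hm P S hS : Lp ℝ ∞ P) ω = S.indicator (fun _ => (1 : ℝ)) ω :=
  LInf.coeFn_ofBound hm _ _ _

theorem LInf.ind_nonneg (hm : m ≤ F) (S : Set Ω) (hS : MeasurableSet[m] S) :
    0 ≤ LInf.ind hm P S hS := by
  rw [LInf.nonneg_iff]
  filter_upwards [LInf.coeFn_ind (P := P) hm S hS] with ω h
  rw [h]
  exact Set.indicator_nonneg (fun _ _ => zero_le_one) ω

/-- A positive functional which is continuous along sequences decreasing to `0` is countably
additive on indicator functions. -/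
theorem hasSum_ind (hm : m ≤ F) (φ : LInf m P →ₗ[ℝ] ℝ) (hpos : ∀ X, 0 ≤ X → 0 ≤ φ X)
    (hφ : ∀ X : ℕ → LInf m P, DecreasesTo X 0 → Tendsto (fun n => φ (X n)) atTop (𝓝 0))
    (f : ℕ → Set Ω) (hf : ∀ i, MeasurableSet[m] (f i)) (hd : Pairwise (Function.onFun Disjoint f)) :
    HasSum (fun i => φ (LInf.ind hm P (f i) (hf i)))
      (φ (LInf.ind hm P (⋃ i, f i) (MeasurableSet.iUnion hf))) := by
  rw [hasSum_iff_tendsto_nat_of_nonneg fun i => hpos _ (LInf.ind_nonneg hm _ _)]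
  have hR : ∀ n, MeasurableSet[m] (⋃ i, f (n + i)) := fun n => MeasurableSet.iUnion fun i => hf _
  -- Indicators of the tails: partial sums telescope to `φ (R 0) - φ (R n)`, and `R n ↓ 0` because a
  -- point lies in at most one `f k`.
  set R : ℕ → LInf m P := fun n => LInf.ind hm P (⋃ i, f (n + i)) (hR n)
  have hstep : ∀ n, R n = LInf.ind hm P (f n) (hf n) + R (n + 1) := by
    intro n
    apply LInf.ext_ae
    filter_upwards [LInf.coeFn_ind (P := P) hm _ (hR n), LInf.coeFn_ind (P := P) hm _ (hR (n + 1)),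
      LInf.coeFn_ind (P := P) hm _ (hf n), LInf.coeFn_add (LInf.ind hm P (f n) (hf n)) (R (n + 1))]
      with ω h1 h2 h3 h4
    rw [h4, h1, h2, h3]
    have hU : ⋃ i, f (n + i) = f n ∪ ⋃ i, f (n + 1 + i) := by
      rw [← Set.union_iUnion_nat_succ]
      simp only [add_zero, add_assoc, add_comm 1]
    have hdis : Disjoint (f n) (⋃ i, f (n + 1 + i)) :=
      Set.disjoint_iUnion_right.2 fun i => hd (by omega)
    rw [hU, Set.indicator_union_of_disjoint hdis]
  have hanti : Antitone R := antitone_nat_of_succ_le fun n => by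
    rw [hstep n]
    exact le_add_of_nonneg_left (LInf.ind_nonneg hm _ _)
  have hdec : DecreasesTo R 0 := by
    refine ⟨hanti, ?_⟩
    filter_upwards [ae_all_iff.2 fun n => LInf.coeFn_ind (P := P) hm _ (hR n),
      LInf.coeFn_zero (m := m) (P := P)] with ω h1 h2
    rw [h2]
    refine tendsto_const_nhds.congr' ?_
    have hev : ∀ᶠ n in atTop, ω ∉ ⋃ i, f (n + i) := by
      by_cases h : ∃ k, ω ∈ f k
      · obtain ⟨k, hk⟩ := h
        filter_upwards [eventually_gt_atTop k] with n hn hmem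
        obtain ⟨i, hi⟩ := Set.mem_iUnion.1 hmem
        exact Set.disjoint_left.1 (hd (show k ≠ n + i by omega)) hk hi
      · filter_upwards with n hmem
        obtain ⟨i, hi⟩ := Set.mem_iUnion.1 hmem
        exact h ⟨_, hi⟩
    filter_upwards [hev] with n hn
    rw [h1 n, Set.indicator_of_notMem hn]
  have hsum : ∀ n, ∑ i ∈ Finset.range n, φ (LInf.ind hm P (f i) (hf i)) = φ (R 0) - φ (R n) := by
    intro n
    induction n with
    | zero => simp
    | succ n ih => rw [Finset.sum_range_succ, ih, hstep n, map_add]; ring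
  have h0 : LInf.ind hm P (⋃ i, f i) (MeasurableSet.iUnion hf) = R 0 := by
    simp only [R, zero_add]
  rw [h0]
  simp only [hsum]
  simpa using (tendsto_const_nhds (x := φ (R 0))).sub (hφ R hdec)

/-- Uniform approximation of bounded measurable functions by simple functions. -/
theorem exists_simpleFunc_close (h : Ω → ℝ) (hh : Measurable[m] h) (C : ℝ) (hC : ∀ ω, |h ω| ≤ C)
    {ε : ℝ} (hε : 0 < ε) : ∃ s : @SimpleFunc Ω m ℝ, ∀ ω, |h ω - s ω| ≤ ε := by
  -- Round `h` down to a multiple of `ε`; boundedness leaves finitely many values.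
  have hfl : Measurable[m] fun ω => ⌊h ω / ε⌋ := Int.measurable_floor.comp (hh.div_const ε)
  refine ⟨⟨fun ω => ε * ⌊h ω / ε⌋, fun x => ?_, ?_⟩, fun ω => ?_⟩
  · exact (Measurable.const_mul (measurable_from_top.comp hfl) ε) (measurableSet_singleton x)
  · refine ((Set.finite_Icc ⌊-C / ε⌋ ⌊C / ε⌋).image fun k : ℤ => ε * (k : ℝ)).subset ?_
    rintro _ ⟨ω, rfl⟩
    obtain ⟨h1, h2⟩ := abs_le.1 (hC ω)
    exact ⟨⌊h ω / ε⌋, ⟨Int.floor_le_floor (by gcongr), Int.floor_le_floor (by gcongr)⟩, rfl⟩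
  · change |h ω - ε * (⌊h ω / ε⌋ : ℝ)| ≤ ε
    have h1 := Int.floor_le (h ω / ε)
    have h2 := (Int.lt_floor_add_one (h ω / ε)).le
    rw [le_div_iff₀ hε] at h1
    rw [div_le_iff₀ hε] at h2
    rw [abs_le]
    constructor <;> linarith

/-- Positivity applied to `C ± X`. This norm bound lets identities on simple functions pass to
uniform limits. -/
theorem abs_map_le [IsFiniteMeasure P] (φ : LInf m P →ₗ[ℝ] ℝ) (hpos : ∀ X, 0 ≤ X → 0 ≤ φ X)
    (X : LInf m P) {C : ℝ} (hC : ∀ᵐ ω ∂P, |(X : Lp ℝ ∞ P) ω| ≤ C) :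
    |φ X| ≤ C * φ (LInf.one m P) := by
  have h1 : 0 ≤ C • LInf.one m P - X := by
    rw [LInf.nonneg_iff]
    filter_upwards [hC, LInf.coeFn_sub (C • LInf.one m P) X, LInf.coeFn_smul C (LInf.one m P),
      LInf.coeFn_one (m := m) (P := P)] with ω h1 h2 h3 h4
    rw [h2, h3, h4]
    linarith [(abs_le.1 h1).2]
  have h2 : 0 ≤ C • LInf.one m P + X := by
    rw [LInf.nonneg_iff]
    filter_upwards [hC, LInf.coeFn_add (C • LInf.one m P) X, LInf.coeFn_smul C (LInf.one m P),
      LInf.coeFn_one (m := m) (P := P)] with ω h1 h2 h3 h4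
    rw [h2, h3, h4]
    linarith [(abs_le.1 h1).1]
  have h3 := hpos _ h1
  have h4 := hpos _ h2
  rw [map_sub, map_smul, smul_eq_mul] at h3
  rw [map_add, map_smul, smul_eq_mul] at h4
  rw [abs_le]
  constructor <;> linarith

/-- A positive functional which is integration against `g` on indicators is integration against
`g`. -/
theorem eq_integral_of_ind [IsFiniteMeasure P] (hm : m ≤ F) (φ : LInf m P →ₗ[ℝ] ℝ)
    (hpos : ∀ X, 0 ≤ X → 0 ≤ φ X) (g : Ω → ℝ) (hg : Integrable g P)
    (hφg : ∀ S hS, φ (LInf.ind hm P S hS) = ∫ ω in S, g ω ∂P) (X : LInf m P) :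
    φ X = ∫ ω, g ω * (X : Lp ℝ ∞ P) ω ∂P := by
  have hsimple : ∀ (s : @SimpleFunc Ω m ℝ) (Y : LInf m P),
      (∀ᵐ ω ∂P, (Y : Lp ℝ ∞ P) ω = s ω) → φ Y = ∫ ω, g ω * (Y : Lp ℝ ∞ P) ω ∂P := by
    intro s
    induction s using SimpleFunc.induction with
    | const c hs =>
      rename_i S
      intro Y hY
      have hYe : Y = c • LInf.ind hm P S hs := by
        apply LInf.ext_ae
        filter_upwards [hY, LInf.coeFn_smul c (LInf.ind hm P S hs), LInf.coeFn_ind (P := P) hm S hs]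
          with ω h1 h2 h3
        rw [h1, h2, h3]
        by_cases hω : ω ∈ S <;> simp [hω]
      rw [hYe, map_smul, hφg, smul_eq_mul, ← integral_const_mul, ← integral_indicator (hm _ hs)]
      refine integral_congr_ae ?_
      filter_upwards [LInf.coeFn_smul c (LInf.ind hm P S hs), LInf.coeFn_ind (P := P) hm S hs]
        with ω h2 h3
      rw [h2, h3]
      by_cases hω : ω ∈ S <;> simp [hω, mul_comm]
    | add hst ihs iht =>
      rename_i s t
      intro Y hY
      obtain ⟨C, hC⟩ := exists_bound_simpleFunc s
      obtain ⟨D, hD⟩ := exists_bound_simpleFunc t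
      have e1 := LInf.coeFn_ofBound (P := P) hm s
        s.stronglyMeasurable.aestronglyMeasurable (ae_of_all _ hC)
      have e2 := LInf.coeFn_ofBound (P := P) hm t
        t.stronglyMeasurable.aestronglyMeasurable (ae_of_all _ hD)
      set Ys := LInf.ofBound (P := P) hm s
        s.stronglyMeasurable.aestronglyMeasurable (ae_of_all _ hC)
      set Yt := LInf.ofBound (P := P) hm t
        t.stronglyMeasurable.aestronglyMeasurable (ae_of_all _ hD)
      have hYe : Y = Ys + Yt := by
        apply LInf.ext_ae
        filter_upwards [hY, e1, e2, LInf.coeFn_add Ys Yt] with ω h1 h2 h3 h4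
        rw [h1, h4, h2, h3]
        rfl
      rw [hYe, map_add, ihs Ys e1, iht Yt e2,
        ← integral_add (Ys.integrable_mul hg) (Yt.integrable_mul hg)]
      refine integral_congr_ae ?_
      filter_upwards [LInf.coeFn_add Ys Yt] with ω h
      rw [h, mul_add]
  obtain ⟨C, hC⟩ := X.exists_bound
  obtain ⟨h₀, hh₀, hXh₀⟩ := X.aestronglyMeasurable
  -- Truncation gives a representative bounded everywhere, as uniform approximation requires.
  set h : Ω → ℝ := fun ω => max (-C) (min (h₀ ω) C) with hhdef
  have hh : Measurable[m] h := measurable_const.max (hh₀.measurable.min measurable_const)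
  have hXh : ∀ᵐ ω ∂P, (X : Lp ℝ ∞ P) ω = h ω := by
    filter_upwards [hC, hXh₀] with ω h1 h2
    rw [h2] at h1 ⊢
    obtain ⟨h3, h4⟩ := abs_le.1 h1
    rw [hhdef]
    simp only [min_eq_left h4, max_eq_right h3]
  have hhC : ∀ ω, |h ω| ≤ |C| := fun ω => by
    refine abs_le.2 ⟨(neg_le_neg (le_abs_self C)).trans (le_max_left _ _), max_le ?_ ?_⟩
    · exact neg_le_abs C
    · exact (min_le_right _ _).trans (le_abs_self C)
  rw [← sub_eq_zero, ← abs_eq_zero]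
  refine le_antisymm (le_of_forall_pos_le_add fun δ hδ => ?_) (abs_nonneg _)
  set K := φ (LInf.one m P) + ∫ ω, |g ω| ∂P with hK
  have hone : 0 ≤ φ (LInf.one m P) := hpos _ <| by
    rw [LInf.nonneg_iff]
    filter_upwards [LInf.coeFn_one (m := m) (P := P)] with ω h
    rw [h]
    exact zero_le_one
  have hK0 : 0 ≤ K := add_nonneg hone (integral_nonneg fun _ => abs_nonneg _)
  -- The two errors add up to at most `ε K`; the `+ 1` covers `K = 0`.
  have hε : 0 < δ / (K + 1) := by positivity
  obtain ⟨s, hs⟩ := exists_simpleFunc_close h hh |C| hhC hε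
  obtain ⟨D, hD⟩ := exists_bound_simpleFunc s
  set Y := LInf.ofBound (P := P) hm s
    s.stronglyMeasurable.aestronglyMeasurable (ae_of_all _ hD)
  have hY := LInf.coeFn_ofBound (P := P) hm s
    s.stronglyMeasurable.aestronglyMeasurable (ae_of_all _ hD)
  have hclose : ∀ᵐ ω ∂P, |((X - Y : LInf m P) : Lp ℝ ∞ P) ω| ≤ δ / (K + 1) := by
    filter_upwards [hXh, hY, LInf.coeFn_sub X Y] with ω h1 h2 h3
    rw [h3, h1, h2]
    exact hs ω
  have h1 := abs_map_le φ hpos _ hclose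
  have h2 : |∫ ω, g ω * ((X - Y : LInf m P) : Lp ℝ ∞ P) ω ∂P| ≤
      δ / (K + 1) * ∫ ω, |g ω| ∂P := by
    rw [← integral_const_mul]
    refine abs_integral_le_integral_abs.trans (integral_mono_ae ((X - Y).integrable_mul hg).abs
      (hg.abs.const_mul _) ?_)
    filter_upwards [hclose] with ω h
    simp only [abs_mul]
    rw [mul_comm]
    exact mul_le_mul_of_nonneg_right h (abs_nonneg _)
  have h3 : ∫ ω, g ω * ((X - Y : LInf m P) : Lp ℝ ∞ P) ω ∂P =
      ∫ ω, g ω * (X : Lp ℝ ∞ P) ω ∂P - ∫ ω, g ω * (Y : Lp ℝ ∞ P) ω ∂P := by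
    rw [← integral_sub (X.integrable_mul hg) (Y.integrable_mul hg)]
    refine integral_congr_ae ?_
    filter_upwards [LInf.coeFn_sub X Y] with ω h
    rw [h, mul_sub]
  have h4 : φ X - ∫ ω, g ω * (X : Lp ℝ ∞ P) ω ∂P =
      φ (X - Y) - ∫ ω, g ω * ((X - Y : LInf m P) : Lp ℝ ∞ P) ω ∂P := by
    rw [map_sub, h3, hsimple s Y hY]
    ring
  rw [h4, zero_add]
  calc _ ≤ δ / (K + 1) * φ (LInf.one m P) + δ / (K + 1) * ∫ ω, |g ω| ∂P :=
        (abs_sub _ _).trans (add_le_add h1 h2)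
    _ = δ * (K / (K + 1)) := by rw [hK]; ring
    _ ≤ δ * 1 := by
        gcongr
        rw [div_le_one (by positivity)]
        linarith
    _ = δ := mul_one δ

/-- A positive functional on `L_∞(m)` which is continuous along sequences decreasing to `0`
has a density in `L_1(m)`. -/
theorem exists_density [IsFiniteMeasure P] (hm : m ≤ F) (φ : LInf m P →ₗ[ℝ] ℝ)
    (hpos : ∀ X, 0 ≤ X → 0 ≤ φ X)
    (hφ : ∀ X : ℕ → LInf m P, DecreasesTo X 0 → Tendsto (fun n => φ (X n)) atTop (𝓝 0)) :
    ∃ g : LOne m P, ∀ X, φ X = ∫ ω, (g : Lp ℝ 1 P) ω * (X : Lp ℝ ∞ P) ω ∂P := by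
  classical
  -- The set function `S ↦ φ(1_S)`, whose Radon-Nikodym derivative is taken with respect to the
  -- trimmed measure so that it is `m`-measurable.
  let v : @SignedMeasure Ω m := by
    letI := m
    refine ⟨fun S => if hS : MeasurableSet[m] S then φ (LInf.ind hm P S hS) else 0, ?_,
      fun S hS => dif_neg hS, fun f hf hd => ?_⟩
    · rw [dif_pos MeasurableSet.empty]
      have : LInf.ind hm P ∅ MeasurableSet.empty = 0 := by
        apply LInf.ext_ae
        filter_upwards [LInf.coeFn_ind (P := P) hm ∅ MeasurableSet.empty,
          LInf.coeFn_zero (m := m) (P := P)] with ω h1 h2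
        rw [h1, h2, Set.indicator_empty]
      rw [this, map_zero]
    · rw [dif_pos (MeasurableSet.iUnion hf)]
      simp only [hf, dif_pos]
      exact hasSum_ind hm φ hpos hφ f hf hd
  have hv : ∀ S (hS : MeasurableSet[m] S), v S = φ (LInf.ind hm P S hS) := fun S hS => dif_pos hS
  have hac : v ≪ᵥ (P.trim hm).toENNRealVectorMeasure := by
    refine VectorMeasure.AbsolutelyContinuous.mk fun S hS h0 => ?_
    rw [Measure.toENNRealVectorMeasure_apply_measurable hS, trim_measurableSet_eq hm hS] at h0
    rw [hv S hS]
    have : LInf.ind hm P S hS = 0 := by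
      apply LInf.ext_ae
      filter_upwards [LInf.coeFn_ind (P := P) hm S hS, measure_eq_zero_iff_ae_notMem.1 h0,
        LInf.coeFn_zero (m := m) (P := P)] with ω h1 h2 h3
      rw [h1, h3, Set.indicator_of_notMem h2]
    rw [this, map_zero]
  have hrn := SignedMeasure.withDensityᵥ_rnDeriv_eq v (P.trim hm) hac
  have hint := SignedMeasure.integrable_rnDeriv v (P.trim hm)
  have hmeas : StronglyMeasurable[m] (v.rnDeriv (P.trim hm)) :=
    (SignedMeasure.measurable_rnDeriv v (P.trim hm)).stronglyMeasurable
  have hint' : Integrable (v.rnDeriv (P.trim hm)) P := integrable_of_integrable_trim hm hint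
  refine ⟨LOne.ofIntegrable _ hint' hmeas.aestronglyMeasurable, fun X => ?_⟩
  rw [eq_integral_of_ind hm φ hpos _ hint' ?_ X]
  · refine integral_congr_ae ?_
    filter_upwards [LOne.coeFn_ofIntegrable _ hint' hmeas.aestronglyMeasurable] with ω h
    rw [h]
  · intro S hS
    rw [← hv S hS, setIntegral_trim hm hmeas hS, ← withDensityᵥ_apply hint hS, hrn]

end Density

end LInfOp

namespace LInfOp

/-! ### Weak* continuity, adjoints and monotone continuity -/

section WeakStar

variable {Ω : Type*} {A B m F : MeasurableSpace Ω} {P : Measure Ω}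

theorem tendsto_weakStar_iff {X : ℕ → LInf m P} {Y : LInf m P} :
    Tendsto X atTop (@nhds _ (weakStar m P) Y) ↔ ∀ f : LOne m P,
      Tendsto (fun n => ∫ ω, (f : Lp ℝ 1 P) ω * (X n : Lp ℝ ∞ P) ω ∂P) atTop
        (𝓝 (∫ ω, (f : Lp ℝ 1 P) ω * (Y : Lp ℝ ∞ P) ω ∂P)) := by
  rw [weakStar, nhds_iInf, tendsto_iInf]
  refine forall_congr' fun f => ?_
  rw [nhds_induced, tendsto_comap_iff]
  rfl

theorem tendsto_weakStarPos_iff {X : ℕ → LInfPos m P} {Y : LInfPos m P} :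
    Tendsto X atTop (@nhds _ (weakStarPos m P) Y) ↔
      Tendsto (fun n => (X n).1) atTop (@nhds _ (weakStar m P) Y.1) := by
  rw [weakStarPos, @nhds_induced _ _ (weakStar m P), tendsto_comap_iff]
  rfl

/-- Both topologies are initial, so it suffices that each test functional on the target pulls back
to one on the source. -/
theorem weakStarContinuous_of_forall_exists {x : LInf B P → LInf A P}
    (h : ∀ f : LOne A P, ∃ g : LOne B P, ∀ X,
      ∫ ω, (f : Lp ℝ 1 P) ω * (x X : Lp ℝ ∞ P) ω ∂P =
        ∫ ω, (g : Lp ℝ 1 P) ω * (X : Lp ℝ ∞ P) ω ∂P) :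
    WeakStarContinuous x := by
  refine continuous_iInf_rng.2 fun f => continuous_induced_rng.2 ?_
  obtain ⟨g, hg⟩ := h f
  refine continuous_iInf_dom (i := g) ?_
  have : (fun X : LInf A P => ∫ ω, (f : Lp ℝ 1 P) ω * (X : Lp ℝ ∞ P) ω ∂P) ∘ x =
      fun X : LInf B P => ∫ ω, (g : Lp ℝ 1 P) ω * (X : Lp ℝ ∞ P) ω ∂P := funext hg
  rw [this]
  exact continuous_induced_dom

/-- Dominated convergence for monotone sequences in `L_∞`, tested against `L_1`. -/
theorem DecreasesTo.tendsto_integral {X : ℕ → LInf m P} {Y : LInf m P} (h : DecreasesTo X Y)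
    {f : Ω → ℝ} (hf : Integrable f P) :
    Tendsto (fun n => ∫ ω, f ω * (X n : Lp ℝ ∞ P) ω ∂P) atTop
      (𝓝 (∫ ω, f ω * (Y : Lp ℝ ∞ P) ω ∂P)) := by
  obtain ⟨C, hC⟩ := (X 0).exists_bound
  obtain ⟨D, hD⟩ := Y.exists_bound
  have hle : ∀ᵐ ω ∂P, Antitone fun n => (X n : Lp ℝ ∞ P) ω := by
    filter_upwards [ae_all_iff.2 fun n => LInf.le_iff.1 (h.1 (Nat.le_succ n))] with ω hω
    exact antitone_nat_of_succ_le hω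
  refine tendsto_integral_of_dominated_convergence (fun ω => |f ω| * (C + D))
    (fun n => ((X n).integrable_mul hf).aestronglyMeasurable) (hf.abs.mul_const _) ?_ ?_
  · intro n
    filter_upwards [hle, h.2, hC, hD] with ω h1 h2 h3 h4
    rw [Real.norm_eq_abs, abs_mul]
    refine mul_le_mul_of_nonneg_left ?_ (abs_nonneg _)
    have h5 : (Y : Lp ℝ ∞ P) ω ≤ (X n : Lp ℝ ∞ P) ω := h1.le_of_tendsto h2 n
    have h6 : (X n : Lp ℝ ∞ P) ω ≤ (X 0 : Lp ℝ ∞ P) ω := h1 (Nat.zero_le n)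
    rw [abs_le] at *
    constructor <;> linarith
  · filter_upwards [h.2] with ω hω
    exact hω.const_mul _

theorem DecreasesTo.tendsto_weakStar {X : ℕ → LInf m P} {Y : LInf m P} (h : DecreasesTo X Y) :
    Tendsto X atTop (@nhds _ (weakStar m P) Y) :=
  tendsto_weakStar_iff.2 fun f => h.tendsto_integral f.integrable

/-- The functional `X ↦ E[f x(X)]`. -/
noncomputable def pairing (x : LInf B P →ₗ[ℝ] LInf A P) {f : Ω → ℝ} (hf : Integrable f P) :
    LInf B P →ₗ[ℝ] ℝ where
  toFun X := ∫ ω, f ω * (x X : Lp ℝ ∞ P) ω ∂P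
  map_add' X Y := by
    rw [← integral_add ((x X).integrable_mul hf) ((x Y).integrable_mul hf), map_add]
    refine integral_congr_ae ?_
    filter_upwards [LInf.coeFn_add (x X) (x Y)] with ω h
    rw [h, mul_add]
  map_smul' c X := by
    rw [RingHom.id_apply, smul_eq_mul, ← integral_const_mul, map_smul]
    refine integral_congr_ae ?_
    filter_upwards [LInf.coeFn_smul c (x X)] with ω h
    rw [h, mul_left_comm]

theorem exists_adjoint_of_nonneg [IsFiniteMeasure P] (hBF : B ≤ F) (x : LInf B P →ₗ[ℝ] LInf A P)
    (hx : Monotone x) {f : Ω → ℝ} (hf : Integrable f P) (hf0 : ∀ ω, 0 ≤ f ω)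
    (h : ∀ X : ℕ → LInf B P, DecreasesTo X 0 →
      Tendsto (fun n => ∫ ω, f ω * (x (X n) : Lp ℝ ∞ P) ω ∂P) atTop (𝓝 0)) :
    ∃ g : LOne B P, ∀ X, ∫ ω, f ω * (x X : Lp ℝ ∞ P) ω ∂P =
      ∫ ω, (g : Lp ℝ 1 P) ω * (X : Lp ℝ ∞ P) ω ∂P := by
  refine exists_density hBF (pairing x hf) (fun X hX => ?_) h
  have h0 : 0 ≤ x X := by simpa using hx hX
  refine integral_nonneg_of_ae ?_
  filter_upwards [LInf.nonneg_iff.1 h0] with ω hω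
  exact mul_nonneg (hf0 ω) hω

theorem aestronglyMeasurable_max_zero {f : Ω → ℝ} (hf : AEStronglyMeasurable[m] f P) :
    AEStronglyMeasurable[m] (fun ω => max (f ω) 0) P :=
  aestronglyMeasurable_sup hf stronglyMeasurable_const.aestronglyMeasurable

/-- A monotone linear operator which is weakly continuous along sequences decreasing to `0`
has an adjoint `L_1(A) → L_1(B)`. -/
theorem exists_adjoint [IsFiniteMeasure P] (hBF : B ≤ F) (x : LInf B P →ₗ[ℝ] LInf A P)
    (hx : Monotone x)
    (h : ∀ f : Ω → ℝ, Integrable f P → AEStronglyMeasurable[A] f P → (∀ ω, 0 ≤ f ω) →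
      ∀ X : ℕ → LInf B P, DecreasesTo X 0 →
      Tendsto (fun n => ∫ ω, f ω * (x (X n) : Lp ℝ ∞ P) ω ∂P) atTop (𝓝 0)) (f : LOne A P) :
    ∃ g : LOne B P, ∀ X, ∫ ω, (f : Lp ℝ 1 P) ω * (x X : Lp ℝ ∞ P) ω ∂P =
      ∫ ω, (g : Lp ℝ 1 P) ω * (X : Lp ℝ ∞ P) ω ∂P := by
  have hp := f.integrable.sup (integrable_const (0 : ℝ))
  have hn := f.integrable.neg.sup (integrable_const (0 : ℝ))
  have hneg : AEStronglyMeasurable[A] (fun ω => -(f : Lp ℝ 1 P) ω) P := by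
    obtain ⟨u, hu, hfu⟩ := f.aestronglyMeasurable
    refine ⟨fun ω => -u ω, hu.neg, ?_⟩
    filter_upwards [hfu] with ω hω
    rw [hω]
  obtain ⟨g₁, hg₁⟩ := exists_adjoint_of_nonneg hBF x hx hp (fun ω => le_max_right _ _)
    (h _ hp (aestronglyMeasurable_max_zero f.aestronglyMeasurable) fun ω => le_max_right _ _)
  obtain ⟨g₂, hg₂⟩ := exists_adjoint_of_nonneg hBF x hx hn (fun ω => le_max_right _ _)
    (h _ hn (aestronglyMeasurable_max_zero hneg) fun ω => le_max_right _ _)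
  refine ⟨g₁ - g₂, fun X => ?_⟩
  have e1 : ∫ ω, ((g₁ - g₂ : LOne B P) : Lp ℝ 1 P) ω * (X : Lp ℝ ∞ P) ω ∂P =
      ∫ ω, (g₁ : Lp ℝ 1 P) ω * (X : Lp ℝ ∞ P) ω ∂P -
        ∫ ω, (g₂ : Lp ℝ 1 P) ω * (X : Lp ℝ ∞ P) ω ∂P := by
    rw [← integral_sub (X.integrable_mul g₁.integrable) (X.integrable_mul g₂.integrable)]
    refine integral_congr_ae ?_
    filter_upwards [Lp.coeFn_sub g₁.1 g₂.1] with ω hω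
    rw [← sub_mul]
    exact congrArg (· * _) hω
  rw [e1, ← hg₁, ← hg₂, ← integral_sub ((x X).integrable_mul hp) ((x X).integrable_mul hn)]
  congr 1
  ext ω
  rw [← sub_mul]
  congr 1
  simp only [Pi.sup_apply, Pi.neg_apply]
  rcases le_total 0 ((f : Lp ℝ 1 P) ω) with h0 | h0
  · rw [max_eq_left h0, max_eq_right (neg_nonpos.2 h0), sub_zero]
  · rw [max_eq_right h0, max_eq_left (neg_nonneg.2 h0), zero_sub, neg_neg]

/-- Continuity from above of a monotone linear operator follows from weak* continuity. -/
theorem continuousFromAbove_of_weakStarContinuous [IsFiniteMeasure P]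
    (x : LInf B P →ₗ[ℝ] LInf A P) (hx : Monotone x) (h : WeakStarContinuous x) :
    ContinuousFromAbove x := by
  intro X Y hXY
  have hanti : Antitone fun n => x (X n) := fun i j hij => hx (hXY.1 hij)
  refine ⟨hanti, ?_⟩
  have hYX : ∀ n, Y ≤ X n := by
    intro n
    rw [LInf.le_iff]
    filter_upwards [hXY.2, ae_all_iff.2 fun k => LInf.le_iff.1 (hXY.1 (Nat.le_add_left n k))]
      with ω h1 h2
    exact le_of_tendsto' ((tendsto_add_atTop_iff_nat n).2 h1) h2
  -- Testing against `f = 1` gives convergence of expectations; for a decreasing sequence bounded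
  -- below by `x Y` this already forces almost sure convergence to `x Y`.
  have hlim := tendsto_weakStar_iff.1
    ((@Continuous.tendsto _ _ (weakStar B P) (weakStar A P) _ h Y).comp hXY.tendsto_weakStar)
    (LOne.ofIntegrable (fun _ => (1 : ℝ)) (integrable_const 1)
      stronglyMeasurable_const.aestronglyMeasurable)
  have hone : ∀ Z : LInf A P, ∫ ω, (LOne.ofIntegrable (m := A) (P := P) (fun _ => (1 : ℝ))
      (integrable_const 1) stronglyMeasurable_const.aestronglyMeasurable : Lp ℝ 1 P) ω *
        (Z : Lp ℝ ∞ P) ω ∂P = ∫ ω, (Z : Lp ℝ ∞ P) ω ∂P := by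
    intro Z
    refine integral_congr_ae ?_
    filter_upwards [LOne.coeFn_ofIntegrable (m := A) (P := P) (fun _ => (1 : ℝ))
      (integrable_const 1) stronglyMeasurable_const.aestronglyMeasurable] with ω hω
    rw [hω, one_mul]
  simp only [hone, Function.comp_apply] at hlim
  refine tendsto_of_integral_tendsto_of_antitone (fun n => (x (X n)).integrable)
    (x Y).integrable hlim ?_ ?_
  · filter_upwards [ae_all_iff.2 fun n => LInf.le_iff.1 (hanti (Nat.le_succ n))] with ω hω
    exact antitone_nat_of_succ_le hω
  · exact ae_all_iff.2 fun n => LInf.le_iff.1 (hx (hYX n))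

theorem weakStarContinuous_of_continuousFromAbove [IsFiniteMeasure P] (hBF : B ≤ F)
    (x : LInf B P →ₗ[ℝ] LInf A P) (hx : Monotone x) (h : ContinuousFromAbove x) :
    WeakStarContinuous x := by
  refine weakStarContinuous_of_forall_exists (exists_adjoint hBF x hx
    fun f hf _ _ X hX => ?_)
  have h1 := (h X 0 hX).tendsto_integral hf
  have h2 : ∫ ω, f ω * (x 0 : Lp ℝ ∞ P) ω ∂P = 0 := by
    rw [map_zero]
    refine integral_eq_zero_of_ae ?_
    filter_upwards [LInf.coeFn_zero (m := A) (P := P)] with ω hω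
    rw [hω, mul_zero, Pi.zero_apply]
  rwa [h2] at h1

theorem decreasesTo_neg_iff {X : ℕ → LInf m P} {Y : LInf m P} :
    DecreasesTo (fun n => -X n) (-Y) ↔ IncreasesTo X Y := by
  refine and_congr ?_ ?_
  · exact ⟨fun h i j hij => neg_le_neg_iff.1 (h hij), fun h i j hij => neg_le_neg (h hij)⟩
  · have hc : ∀ᵐ ω ∂P, (∀ n, ((-X n : LInf m P) : Lp ℝ ∞ P) ω = -(X n : Lp ℝ ∞ P) ω) ∧
        ((-Y : LInf m P) : Lp ℝ ∞ P) ω = -(Y : Lp ℝ ∞ P) ω :=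
      (ae_all_iff.2 fun n => LInf.coeFn_neg (X n)).and (LInf.coeFn_neg Y)
    refine eventually_congr ?_
    filter_upwards [hc] with ω h
    simp only [h.1, h.2]
    exact ⟨fun h => by simpa using h.neg, fun h => h.neg⟩

/-- Linearity lets `X ↦ -X` exchange increasing and decreasing sequences. -/
theorem continuousFromBelow_iff_continuousFromAbove (x : LInf B P →ₗ[ℝ] LInf A P) :
    ContinuousFromBelow x ↔ ContinuousFromAbove x := by
  constructor
  · intro h X Y hXY
    have h1 : IncreasesTo (fun n => -X n) (-Y) := by
      rw [← decreasesTo_neg_iff]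
      simpa using hXY
    have h2 := decreasesTo_neg_iff.2 (h _ _ h1)
    simpa using h2
  · intro h X Y hXY
    have h2 := h _ _ (decreasesTo_neg_iff.2 hXY)
    simp only [map_neg] at h2
    exact decreasesTo_neg_iff.1 h2

end WeakStar

end LInfOp

namespace LInfOp

/-! ### Sandwich extension, continuity from the majorant, and homogeneity -/

section Sandwich

variable {Ω : Type*} {A B F : MeasurableSpace Ω} {P : Measure Ω}

theorem map_zero_of_homogeneous {M : LInfPos B P → LInfPos A P}
    (hM : ∀ (c : ℝ), 0 ≤ c → ∀ X Z : LInfPos B P, Z.1 = c • X.1 → (M Z).1 = c • (M X).1)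
    {Z : LInfPos B P} (hZ : Z.1 = 0) : (M Z).1 = 0 := by
  have := hM 0 le_rfl Z Z (by rw [hZ, smul_zero])
  rwa [zero_smul] at this

/-- The cone of pairs `(X, V)` such that `M(Y) - m(Z) ≤ V` for some `Y, Z ≥ 0` with
`Z + X ≤ Y`. -/
def sandwichCone {m M : LInfPos B P → LInfPos A P} (hM : Sublinear M) (hm : Superlinear m) :
    PointedCone ℝ (LInf B P × LInf A P) where
  carrier := {q | ∃ Y Z : LInfPos B P, Z.1 + q.1 ≤ Y.1 ∧ (M Y).1 - (m Z).1 ≤ q.2}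
  zero_mem' := by
    refine ⟨⟨0, le_rfl⟩, ⟨0, le_rfl⟩, by simp, ?_⟩
    rw [map_zero_of_homogeneous hM.2 rfl, map_zero_of_homogeneous hm.2 rfl]
    simp
  add_mem' := by
    rintro ⟨X, V⟩ ⟨X', V'⟩ ⟨Y, Z, h, hV⟩ ⟨Y', Z', h', hV'⟩
    refine ⟨⟨Y.1 + Y'.1, add_nonneg Y.2 Y'.2⟩, ⟨Z.1 + Z'.1, add_nonneg Z.2 Z'.2⟩, ?_, ?_⟩
    · have := add_le_add h h'
      rwa [add_add_add_comm] at this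
    · refine (sub_le_sub (hM.1 Y Y' _ rfl) (hm.1 Z Z' _ rfl)).trans ?_
      have := add_le_add hV hV'
      rwa [← add_sub_add_comm] at this
  smul_mem' := by
    rintro ⟨c, hc⟩ ⟨X, V⟩ ⟨Y, Z, h, hV⟩
    refine ⟨⟨c • Y.1, smul_nonneg hc Y.2⟩, ⟨c • Z.1, smul_nonneg hc Z.2⟩, ?_, ?_⟩
    · have := smul_le_smul_of_nonneg_left h hc
      rwa [smul_add] at this
    · rw [hM.2 c hc Y _ rfl, hm.2 c hc Z _ rfl, ← smul_sub]
      exact smul_le_smul_of_nonneg_left hV hc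

theorem LInf.exists_nonneg_ge [IsFiniteMeasure P] (X : LInf B P) : ∃ Y : LInfPos B P, X ≤ Y.1 := by
  obtain ⟨C, hC⟩ := X.exists_bound
  have h1 : 0 ≤ |C| • LInf.one B P := by
    rw [LInf.nonneg_iff]
    filter_upwards [LInf.coeFn_smul |C| (LInf.one B P), LInf.coeFn_one (m := B) (P := P)]
      with ω h1 h2
    rw [h1, h2, mul_one]
    exact abs_nonneg C
  refine ⟨⟨_, h1⟩, LInf.le_iff.2 ?_⟩
  filter_upwards [hC, LInf.coeFn_smul |C| (LInf.one B P), LInf.coeFn_one (m := B) (P := P)]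
    with ω h1 h2 h3
  rw [h2, h3, mul_one]
  exact (le_abs_self _).trans (h1.trans (le_abs_self C))

/-- Sandwich extension theorem. -/
theorem exists_sandwich_extension [IsFiniteMeasure P] (hAF : A ≤ F) (L : Submodule ℝ (LInf B P))
    (x : L →ₗ[ℝ] LInf A P) (m M : LInfPos B P → LInfPos A P) (hM : Sublinear M)
    (hm : Superlinear m) (hx : SandwichCondition x m M) :
    ∃ x' : LInf B P →ₗ[ℝ] LInf A P, (∀ X : L, x' X = x X) ∧
      ∀ (X : LInf B P) (Y Z : LInfPos B P), Z.1 + X ≤ Y.1 → (m Z).1 + x' X ≤ (M Y).1 := by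
  have hne : ∀ X, ∃ V, (X, V) ∈ sandwichCone hM hm := fun X => by
    obtain ⟨Y, hY⟩ := X.exists_nonneg_ge
    exact ⟨_, Y, ⟨0, le_rfl⟩, by simpa using hY, le_rfl⟩
  obtain ⟨x', h1, h2⟩ := exists_extension_of_cone (fun S => LInf.exists_isLUB hAF S)
    (sandwichCone hM hm) hne ⟨L, x⟩ fun X V ⟨Y, Z, h, hV⟩ =>
      (le_sub_iff_add_le'.2 (hx X Y Z h)).trans hV
  refine ⟨x', h1, fun X Y Z h => ?_⟩
  rw [← le_sub_iff_add_le']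
  exact h2 X _ ⟨Y, Z, h, le_rfl⟩

theorem le_and_le_of_sandwich {m M : LInfPos B P → LInfPos A P} (hM : Sublinear M)
    (hm : Superlinear m) {x : LInf B P →ₗ[ℝ] LInf A P}
    (hx : ∀ (X : LInf B P) (Y Z : LInfPos B P), Z.1 + X ≤ Y.1 → (m Z).1 + x X ≤ (M Y).1)
    (X : LInfPos B P) : (m X).1 ≤ x X.1 ∧ x X.1 ≤ (M X).1 := by
  constructor
  -- Taking `-X` with `Z = X` and `Y = 0` gives `m(X) - x(X) ≤ M(0) = 0`.
  · have := hx (-X.1) ⟨0, le_rfl⟩ X (by simp)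
    rw [map_zero_of_homogeneous hM.2 rfl, map_neg, ← sub_eq_add_neg, sub_nonpos] at this
    exact this
  · have := hx X.1 X ⟨0, le_rfl⟩ (by simp)
    rwa [map_zero_of_homogeneous hm.2 rfl, zero_add] at this

/-- The lower bound `m` takes non-negative values, so `0 ≤ m(Y - X) ≤ x(Y - X)`. -/
theorem monotone_of_sandwich {m M : LInfPos B P → LInfPos A P} (hM : Sublinear M)
    (hm : Superlinear m) {x : LInf B P →ₗ[ℝ] LInf A P}
    (hx : ∀ (X : LInf B P) (Y Z : LInfPos B P), Z.1 + X ≤ Y.1 → (m Z).1 + x X ≤ (M Y).1) :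
    Monotone x := by
  intro X Y h
  have h1 := (m ⟨Y - X, sub_nonneg.2 h⟩).2.trans
    (le_and_le_of_sandwich hM hm hx ⟨Y - X, sub_nonneg.2 h⟩).1
  rwa [map_sub, sub_nonneg] at h1

/-- A monotone linear operator dominated on the positive cone by a weak* continuous sublinear
operator has an adjoint. -/
theorem exists_adjoint_of_le [IsFiniteMeasure P] (hBF : B ≤ F) {M : LInfPos B P → LInfPos A P}
    (hMc : WeakStarContinuousPos M) (hM : Sublinear M) {x : LInf B P →ₗ[ℝ] LInf A P}
    (hx : Monotone x) (hxM : ∀ X : LInfPos B P, x X.1 ≤ (M X).1) (f : LOne A P) :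
    ∃ g : LOne B P, ∀ X, ∫ ω, (f : Lp ℝ 1 P) ω * (x X : Lp ℝ ∞ P) ω ∂P =
      ∫ ω, (g : Lp ℝ 1 P) ω * (X : Lp ℝ ∞ P) ω ∂P := by
  refine exists_adjoint hBF x hx (fun f hf hfm hf0 X hX => ?_) f
  have hX0 : ∀ n, 0 ≤ X n := by
    intro n
    rw [LInf.nonneg_iff]
    filter_upwards [hX.2, ae_all_iff.2 fun k => LInf.le_iff.1 (hX.1 (Nat.le_add_left n k)),
      LInf.coeFn_zero (m := B) (P := P)] with ω h1 h2 h3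
    rw [h3] at h1
    exact le_of_tendsto' ((tendsto_add_atTop_iff_nat n).2 h1) h2
  set X' : ℕ → LInfPos B P := fun n => ⟨X n, hX0 n⟩
  have h1 : Tendsto X' atTop (@nhds _ (weakStarPos B P) ⟨0, le_rfl⟩) :=
    tendsto_weakStarPos_iff.2 hX.tendsto_weakStar
  have h2 := (@Continuous.tendsto _ _ (weakStarPos B P) (weakStarPos A P) _ hMc ⟨0, le_rfl⟩).comp h1
  have h3 := tendsto_weakStar_iff.1 (tendsto_weakStarPos_iff.1 h2) (LOne.ofIntegrable f hf hfm)
  have hfc := LOne.coeFn_ofIntegrable f hf hfm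
  rw [map_zero_of_homogeneous hM.2 rfl] at h3
  have h4 : ∫ ω, (LOne.ofIntegrable f hf hfm : Lp ℝ 1 P) ω *
      ((0 : LInf A P) : Lp ℝ ∞ P) ω ∂P = 0 := by
    refine integral_eq_zero_of_ae ?_
    filter_upwards [LInf.coeFn_zero (m := A) (P := P)] with ω hω
    rw [hω, mul_zero, Pi.zero_apply]
  rw [h4] at h3
  -- `0 ≤ E[f x(X_n)] ≤ E[f M(X_n)]`, and the right side tends to `E[f M(0)] = 0`.
  refine squeeze_zero (fun n => ?_) (fun n => ?_) h3
  · have h0 : 0 ≤ x (X n) := by simpa using hx (hX0 n)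
    refine integral_nonneg_of_ae ?_
    filter_upwards [LInf.nonneg_iff.1 h0] with ω hω
    exact mul_nonneg (hf0 ω) hω
  · refine integral_mono_ae ((x (X n)).integrable_mul hf)
      ((M (X' n)).1.integrable_mul (LOne.integrable _)) ?_
    filter_upwards [LInf.le_iff.1 (hxM (X' n)), hfc] with ω h5 h6
    simp only [Function.comp_apply, h6]
    exact mul_le_mul_of_nonneg_left h5 (hf0 ω)

/-- Domination by a weakly `A`-homogeneous operator makes `x` commute with indicators. -/
theorem map_indicator_of_nonneg (hAB : A ≤ B) (hBF : B ≤ F) {M : LInfPos B P → LInfPos A P}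
    (hMh : WeakHomogeneousPos M) {x : LInf B P →ₗ[ℝ] LInf A P}
    (hx : Monotone x) (hxM : ∀ X : LInfPos B P, x X.1 ≤ (M X).1) (S : Set Ω)
    (hS : MeasurableSet[A] S) (X : LInf B P) (hX : 0 ≤ X) :
    ∀ᵐ ω ∂P, (x (LInf.indicator hBF S (hAB _ hS) X) : Lp ℝ ∞ P) ω =
      S.indicator (x X : Lp ℝ ∞ P) ω := by
  -- From `0 ≤ x(1_T X) ≤ 1_T M(X)`. Used for `S` and its complement, this locates the two summands
  -- of `x X` on disjoint sets.
  have hvanish : ∀ T (hT : MeasurableSet[A] T), ∀ᵐ ω ∂P, ω ∉ T →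
      (x (LInf.indicator hBF T (hAB _ hT) X) : Lp ℝ ∞ P) ω = 0 := by
    intro T hT
    have hc := LInf.coeFn_indicator hBF T (hAB _ hT) X
    have h0 : 0 ≤ LInf.indicator hBF T (hAB _ hT) X := by
      rw [LInf.nonneg_iff]
      filter_upwards [hc, LInf.nonneg_iff.1 hX] with ω h1 h2
      rw [h1]
      exact Set.indicator_apply_nonneg fun _ => h2
    have h1 : 0 ≤ x (LInf.indicator hBF T (hAB _ hT) X) := by simpa using hx h0
    filter_upwards [LInf.nonneg_iff.1 h1, LInf.le_iff.1 (hxM ⟨_, h0⟩),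
      hMh T hT ⟨X, hX⟩ ⟨_, h0⟩ hc] with ω h2 h3 h4 hω
    rw [h4, Set.indicator_of_notMem hω] at h3
    exact le_antisymm h3 h2
  have hsum : x X = x (LInf.indicator hBF S (hAB _ hS) X) +
      x (LInf.indicator hBF Sᶜ (hAB _ hS.compl) X) := by
    rw [← map_add]
    congr 1
    apply LInf.ext_ae
    filter_upwards [LInf.coeFn_indicator hBF S (hAB _ hS) X,
      LInf.coeFn_indicator hBF Sᶜ (hAB _ hS.compl) X,
      LInf.coeFn_add (LInf.indicator hBF S (hAB _ hS) X)
        (LInf.indicator hBF Sᶜ (hAB _ hS.compl) X)] with ω h1 h2 h3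
    rw [h3, h1, h2]
    by_cases h : ω ∈ S <;> simp [h]
  filter_upwards [hvanish S hS, hvanish Sᶜ hS.compl,
    LInf.coeFn_add (x (LInf.indicator hBF S (hAB _ hS) X))
      (x (LInf.indicator hBF Sᶜ (hAB _ hS.compl) X))] with ω h1 h2 h3
  rw [hsum]
  by_cases h : ω ∈ S
  · rw [Set.indicator_of_mem h, h3, h2 (fun h' => h' h), add_zero]
  · rw [Set.indicator_of_notMem h, h1 h]

/-- By linearity from the non-negative case, writing `X = Y - (Y - X)` with `Y ≥ 0` and `Y ≥ X`. -/
theorem map_indicator [IsFiniteMeasure P] (hAB : A ≤ B) (hBF : B ≤ F)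
    {M : LInfPos B P → LInfPos A P}
    (hMh : WeakHomogeneousPos M) {x : LInf B P →ₗ[ℝ] LInf A P}
    (hx : Monotone x) (hxM : ∀ X : LInfPos B P, x X.1 ≤ (M X).1) (S : Set Ω)
    (hS : MeasurableSet[A] S) (X : LInf B P) :
    ∀ᵐ ω ∂P, (x (LInf.indicator hBF S (hAB _ hS) X) : Lp ℝ ∞ P) ω =
      S.indicator (x X : Lp ℝ ∞ P) ω := by
  obtain ⟨Y, hY⟩ := X.exists_nonneg_ge
  have e : X = Y.1 - (Y.1 - X) := (sub_sub_cancel _ _).symm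
  have e' : LInf.indicator hBF S (hAB _ hS) X = LInf.indicator hBF S (hAB _ hS) Y.1 -
      LInf.indicator hBF S (hAB _ hS) (Y.1 - X) := by
    apply LInf.ext_ae
    filter_upwards [LInf.coeFn_indicator hBF S (hAB _ hS) X,
      LInf.coeFn_indicator hBF S (hAB _ hS) Y.1,
      LInf.coeFn_indicator hBF S (hAB _ hS) (Y.1 - X),
      LInf.coeFn_sub Y.1 X, LInf.coeFn_sub (LInf.indicator hBF S (hAB _ hS) Y.1)
        (LInf.indicator hBF S (hAB _ hS) (Y.1 - X))] with ω h1 h2 h3 h4 h5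
    rw [h5, h1, h2, h3]
    by_cases h : ω ∈ S <;> simp only [h, Set.indicator_of_mem, Set.indicator_of_notMem,
      not_false_eq_true, sub_self]
    rw [h4]
    ring
  have hxX : x X = x Y.1 - x (Y.1 - X) := by rw [← map_sub, ← e]
  rw [e', hxX, map_sub]
  filter_upwards [map_indicator_of_nonneg hAB hBF hMh hx hxM S hS Y.1 Y.2,
    map_indicator_of_nonneg hAB hBF hMh hx hxM S hS (Y.1 - X) (sub_nonneg.2 hY),
    LInf.coeFn_sub (x Y.1) (x (Y.1 - X)),
    LInf.coeFn_sub (x (LInf.indicator hBF S (hAB _ hS) Y.1))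
      (x (LInf.indicator hBF S (hAB _ hS) (Y.1 - X)))] with ω h1 h2 h3 h4
  rw [h4, h1, h2]
  by_cases h : ω ∈ S <;> simp only [h, Set.indicator_of_mem, Set.indicator_of_notMem,
    not_false_eq_true, sub_self]
  rw [h3]

/-- An operator with an adjoint which commutes with indicators of sets in `A` is
`A`-homogeneous, being a weighted conditional expectation. -/
theorem homogeneous_of_map_indicator [IsFiniteMeasure P] (hAB : A ≤ B) (hBF : B ≤ F)
    {x : LInf B P →ₗ[ℝ] LInf A P}
    (hadj : ∀ f : LOne A P, ∃ g : LOne B P, ∀ X,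
      ∫ ω, (f : Lp ℝ 1 P) ω * (x X : Lp ℝ ∞ P) ω ∂P =
        ∫ ω, (g : Lp ℝ 1 P) ω * (X : Lp ℝ ∞ P) ω ∂P)
    (hind : ∀ (S : Set Ω) (hS : MeasurableSet[A] S) (X : LInf B P),
      ∀ᵐ ω ∂P, (x (LInf.indicator hBF S (hAB _ hS) X) : Lp ℝ ∞ P) ω =
        S.indicator (x X : Lp ℝ ∞ P) ω) :
    Homogeneous x := by
  obtain ⟨g, hg⟩ := hadj (LOne.ofIntegrable (fun _ => (1 : ℝ)) (integrable_const 1)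
      stronglyMeasurable_const.aestronglyMeasurable)
  have hg' : ∀ X, ∫ ω, (x X : Lp ℝ ∞ P) ω ∂P =
      ∫ ω, (g : Lp ℝ 1 P) ω * (X : Lp ℝ ∞ P) ω ∂P := by
    intro X
    rw [← hg X]
    refine integral_congr_ae ?_
    filter_upwards [LOne.coeFn_ofIntegrable (m := A) (P := P) (fun _ => (1 : ℝ))
      (integrable_const 1) stronglyMeasurable_const.aestronglyMeasurable] with ω hω
    rw [hω, one_mul]
  have hAF := hAB.trans hBF
  -- For `S` in `A`, `E[1_S x(X)] = E[x(1_S X)] = E[g 1_S X]`, which characterizes the conditional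
  -- expectation of `g X`.
  have hcond : ∀ X : LInf B P, (x X : Lp ℝ ∞ P) =ᵐ[P]
      P[fun ω => (g : Lp ℝ 1 P) ω * (X : Lp ℝ ∞ P) ω | A] := by
    intro X
    refine ae_eq_condExp_of_forall_setIntegral_eq hAF (X.integrable_mul g.integrable)
      (fun S _ _ => (x X).integrable.integrableOn) (fun S hS _ => ?_) (x X).aestronglyMeasurable
    rw [← integral_indicator (hAF _ hS), ← integral_indicator (hAF _ hS),
      ← integral_congr_ae (hind S hS X), hg']
    refine integral_congr_ae ?_
    filter_upwards [LInf.coeFn_indicator hBF S (hAB _ hS) X] with ω h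
    rw [h]
    by_cases hω : ω ∈ S <;> simp [hω]
  intro c X Y hY
  have e : (fun ω => (g : Lp ℝ 1 P) ω * (Y : Lp ℝ ∞ P) ω) =ᵐ[P]
      (c.1 : Lp ℝ ∞ P) * fun ω => (g : Lp ℝ 1 P) ω * (X : Lp ℝ ∞ P) ω := by
    filter_upwards [hY] with ω h
    rw [Pi.mul_apply, h, mul_left_comm]
  obtain ⟨C, hC⟩ := c.1.exists_bound
  have hpull := condExp_stronglyMeasurable_mul_of_bound₀ hAF c.1.aestronglyMeasurable
    (X.integrable_mul g.integrable) C hC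
  filter_upwards [hcond Y, hcond X, condExp_congr_ae (m := A) e, hpull] with ω h1 h2 h3 h4
  rw [h1, h2, h3, h4, Pi.mul_apply]

theorem superlinear_zero : Superlinear (fun _ : LInfPos B P => (⟨0, le_rfl⟩ : LInfPos A P)) :=
  ⟨fun _ _ _ _ => by simp, fun _ _ _ _ _ => by simp⟩

end Sandwich

end LInfOp

theorem mainTheorem10 {Ω : Type*} (A B F : MeasurableSpace Ω) (hAB : A ≤ B) (hBF : B ≤ F)
    (P : Measure Ω) [IsProbabilityMeasure P] :
    -- equivalence of the three notions of continuity
    (∀ x : LInf B P →ₗ[ℝ] LInf A P, Homogeneous x → Monotone x →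
      x (LInf.one B P) = LInf.one A P →
      [ContinuousFromBelow x, ContinuousFromAbove x, WeakStarContinuous x].TFAE) ∧
    -- majorant preserving extension
    (∀ (L : Submodule ℝ (LInf B P)) (x : L →ₗ[ℝ] LInf A P) (M : LInfPos B P → LInfPos A P),
      (∀ X Y : L, (X : LInf B P) ≤ Y → x X ≤ x Y) →
      WeakStarContinuousPos M → WeakHomogeneousPos M → Sublinear M → MajorantCondition x M →
      ∃ x' : LInf B P →ₗ[ℝ] LInf A P,
        (∀ X : L, x' X = x X) ∧ Monotone x' ∧
        (∀ (X : LInf B P) (Y : LInfPos B P), X ≤ Y.1 → x' X ≤ (M Y).1) ∧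
        WeakStarContinuous x' ∧ Homogeneous x') ∧
    -- sandwich preserving extension
    (∀ (L : Submodule ℝ (LInf B P)) (x : L →ₗ[ℝ] LInf A P) (m M : LInfPos B P → LInfPos A P),
      WeakStarContinuousPos M → Sublinear M → Superlinear m → SandwichCondition x m M →
      ∃ x' : LInf B P →ₗ[ℝ] LInf A P,
        (∀ X : L, x' X = x X) ∧ Monotone x' ∧ WeakStarContinuous x' ∧
        (∀ (X : LInf B P) (Y Z : LInfPos B P), Z.1 + X ≤ Y.1 → (m Z).1 + x' X ≤ (M Y).1) ∧
        (∀ X : LInfPos B P, (m X).1 ≤ x' X.1 ∧ x' X.1 ≤ (M X).1)) := by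
  refine ⟨fun x _ hx _ => ?_, fun L x M _ hMc hMh hM hxM => ?_, fun L x m M hMc hM hm hxM => ?_⟩
  · tfae_have 1 ↔ 2 := continuousFromBelow_iff_continuousFromAbove x
    tfae_have 2 → 3 := weakStarContinuous_of_continuousFromAbove hBF x hx
    tfae_have 3 → 2 := continuousFromAbove_of_weakStarContinuous x hx
    tfae_finish
  -- The majorant condition is the sandwich condition with `m = 0`, because `Z ≥ 0` and `Z + X ≤ Y`
  -- imply `X ≤ Y`.
  · obtain ⟨x', hext, hs⟩ := exists_sandwich_extension (hAB.trans hBF) L x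
      (fun _ => ⟨0, le_rfl⟩) M hM superlinear_zero
      (fun X Y Z h => by simpa using hxM X Y ((le_add_of_nonneg_left Z.2).trans h))
    have hmono := monotone_of_sandwich hM superlinear_zero hs
    have hle := fun X => (le_and_le_of_sandwich hM superlinear_zero hs X).2
    have hadj := exists_adjoint_of_le hBF hMc hM hmono hle
    refine ⟨x', hext, hmono, fun X Y h => ?_, weakStarContinuous_of_forall_exists hadj,
      homogeneous_of_map_indicator hAB hBF hadj fun S hS X =>
        map_indicator hAB hBF hMh hmono hle S hS X⟩
    exact (hmono h).trans (hle Y)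
  · obtain ⟨x', hext, hs⟩ := exists_sandwich_extension (hAB.trans hBF) L x m M hM hm hxM
    have hmono := monotone_of_sandwich hM hm hs
    have hle := le_and_le_of_sandwich hM hm hs
    exact ⟨x', hext, hmono, weakStarContinuous_of_forall_exists
      (exists_adjoint_of_le hBF hMc hM hmono fun X => (hle X).2), hs, hle⟩
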